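/- For a sequence $(a(n))_{n\ge 0}$ let $r(n,x)=\sum_{k=0}^n a(n-k)x^k$ and $d(n,x)=\det\bigl(r(i+j,x)\bigr)_{i,j=0}^n$. For a sequence $t=(t_n)_{n\ge0}$ let the polynomials $p_n(x,t)$ be defined by $p_{-1}(x,t)=0$, $p_0(x,t)=1$ and $p_n(x,t)=x\,p_{n-1}(x,t)-t_{n-2}\,p_{n-2}(x,t)$ for $n\ge 1$ (for $n=1$ the last term is $0$). Let $t=(1,2,1,2,1,2,\dots)$ and $T=(t_{n+1})_{n\ge0}=(2,1,2,1,\dots)$, and let $\binom{-1}{0}=1$. Let $x$ be an element of a field of characteristic $0$ (for instance an indeterminate) and let $n\ge 0$. (1) If $(a(n))_{n\ge0}=(1,1,3,11,45,197,\dots)$ is the sequence of little Schröder numbers, then $d(n,0)\ne0$ and $$\frac{d(n,x^2)}{d(n,0)}=\frac{(-1)^n}{2^n}\,p_{2n}(x,T)=\sum_{k=0}^n(-1)^kx^{2k}\sum_{j=0}^{n-k}\binom{n-j}{k}\binom{k+j-1}{j}2^{-k-j}.$$ (2) If $(a(n))_{n\ge0}=(1,2,6,22,90,394,\dots)$ is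 the sequence of large Schröder numbers, then $d(n,0)\ne0$ and $$\frac{d(n,x^2)}{d(n,0)}=(-1)^n\,p_{2n}(x,t)=\sum_{k=0}^n(-1)^kx^{2k}\sum_{j=0}^{n-k}\binom{n-j}{k}\binom{k+j-1}{j}2^{j}.$$ -/

import Mathlib

open Finset Polynomial

/-- The little Schröder numbers `1, 1, 3, 11, 45, 197, …` indexed from `0`. Mathlib's `smallSchroder`
is the same sequence with one further `1` in front, hence the shift of the index. -/
def littleSchroder (n : ℕ) : ℕ := Nat.smallSchroder (n + 1)

/-- `r(n, x) = ∑_{k=0}^n a(n-k) x^k`. -/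
def sumPoly {R : Type*} [CommRing R] (a : ℕ → R) (n : ℕ) (x : R) : R :=
  ∑ k ∈ range (n + 1), a (n - k) * x ^ k

/-- `d(n, x) = det (r(i+j, x))_{i,j=0}^n`. -/
def hankelDet {R : Type*} [CommRing R] (a : ℕ → R) (n : ℕ) (x : R) : R :=
  (Matrix.of fun i j : Fin (n + 1) => sumPoly a ((i : ℕ) + (j : ℕ)) x).det

/-- The monic symmetric orthogonal polynomials associated with the sequence `t`:
`p_n = X p_{n-1} - t_{n-2} p_{n-2}` with `p_{-1} = 0` and `p_0 = 1` (so that `p_1 = X`). -/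
noncomputable def symmOrthPoly {R : Type*} [CommRing R] (t : ℕ → R) : ℕ → R[X]
  | 0 => 1
  | 1 => X
  | n + 2 => X * symmOrthPoly t (n + 1) - C (t n) * symmOrthPoly t n

/-- The sequence `1, 2, 1, 2, 1, 2, …`. -/
def oneTwo (R : Type*) [CommRing R] (m : ℕ) : R := if Even m then 1 else 2

/-! ### Hankel determinants of a Stieltjes continued fraction -/

section ContinuedFraction

variable {R : Type*} [CommRing R]

/-! Let `h 0` be the Stieltjes fraction with coefficients `t` and tails `h n`. The convergent
denominator `D = fracDenom t (2n+1)` has degree at most `n`, and `D * h 0` agrees up to degree `2n`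
with a numerator, also of degree at most `n`, which is the denominator of the fraction shifted by
one (`fracDenom_mul_sub`). Hence the coefficients of `D * h 0` in degrees `n+1, …, 2n` vanish. Row
operations reduce `d(n, y)` to a matrix with rows `a(i+j)` below a first row `r(j, y)`; combining
columns with the coefficients of `D` clears all but the top entry. For `y = x²` that entry is
`p_{2n}` of the shifted `t`, and the cofactor, free of `y`, cancels in the quotient
(`hankelDet_sq_eq`). Both Schröder series are tails of the fraction 1, 2, 1, 2, …, and the binomial
sums obey the recurrence of the even-indexed `p_{2n}`. -/

/-- The polynomials `z ^ n * p_n(1 / z, t)` as power series in `z ^ 2`; these are the denominators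
of the convergents of the continued fraction `1 / (1 - t₀ X / (1 - t₁ X / ⋯))`. -/
noncomputable def fracDenom (t : ℕ → R) : ℕ → PowerSeries R
  | 0 => 1
  | 1 => 1
  | n + 2 => fracDenom t (n + 1) - PowerSeries.C (t n) * PowerSeries.X * fracDenom t n

lemma fracDenom_add_two (t : ℕ → R) (n : ℕ) : fracDenom t (n + 2) =
    fracDenom t (n + 1) - PowerSeries.C (t n) * PowerSeries.X * fracDenom t n := by
  rw [fracDenom]

lemma coeff_fracDenom_zero (t : ℕ → R) : ∀ n, PowerSeries.coeff 0 (fracDenom t n) = 1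
  | 0 => by simp [fracDenom]
  | 1 => by simp [fracDenom]
  | n + 2 => by
    have := coeff_fracDenom_zero t (n + 1)
    simp_all [fracDenom]

lemma coeff_fracDenom_succ (t : ℕ → R) (n k : ℕ) :
    PowerSeries.coeff (k + 1) (fracDenom t (n + 2)) =
      PowerSeries.coeff (k + 1) (fracDenom t (n + 1)) -
        t n * PowerSeries.coeff k (fracDenom t n) := by
  rw [fracDenom, map_sub, mul_assoc, PowerSeries.coeff_C_mul, PowerSeries.coeff_succ_X_mul]

lemma coeff_fracDenom_eq_zero (t : ℕ → R) :
    ∀ n k, n < 2 * k → PowerSeries.coeff k (fracDenom t n) = 0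
  | _, 0, h => by omega
  | 0, k + 1, _ => by simp [fracDenom, PowerSeries.coeff_one]
  | 1, k + 1, _ => by simp [fracDenom, PowerSeries.coeff_one]
  | n + 2, k + 1, h => by
    rw [coeff_fracDenom_succ, coeff_fracDenom_eq_zero t (n + 1) (k + 1) (by omega),
      coeff_fracDenom_eq_zero t n k (by omega), mul_zero, sub_zero]

lemma eval_symmOrthPoly_eq_sum (t : ℕ → R) (x : R) :
    ∀ m N, m ≤ 2 * N + 1 → (symmOrthPoly t m).eval x =
      ∑ k ∈ range (N + 1), PowerSeries.coeff k (fracDenom t m) * x ^ (m - 2 * k)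
  | 0, N, _ => by
    simp [symmOrthPoly, fracDenom, PowerSeries.coeff_one]
  | 1, N, _ => by
    simp [symmOrthPoly, fracDenom, PowerSeries.coeff_one]
  | m + 2, 0, h => by omega
  | m + 2, N + 1, h => by
    rw [symmOrthPoly, eval_sub, eval_mul, eval_mul, eval_X, eval_C,
      eval_symmOrthPoly_eq_sum t x (m + 1) (N + 1) (by omega),
      eval_symmOrthPoly_eq_sum t x m N (by omega), sum_range_succ', sum_range_succ' _ (N + 1),
      coeff_fracDenom_zero, coeff_fracDenom_zero, mul_add, mul_sum, mul_sum, add_sub_right_comm,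
      ← sum_sub_distrib]
    congr 1
    · refine sum_congr rfl fun k _ => ?_
      rw [coeff_fracDenom_succ, show m + 2 - 2 * (k + 1) = m - 2 * k by omega]
      -- Truncated subtraction breaks the exponent identity exactly where the coefficient is zero.
      rcases Nat.lt_or_ge (m + 1) (2 * (k + 1)) with hk | hk
      · rw [coeff_fracDenom_eq_zero t _ _ hk]
        ring
      · rw [show m - 2 * k = m + 1 - 2 * (k + 1) + 1 by omega]
        ring
    · simp only [mul_zero, Nat.sub_zero]
      ring

lemma eval_symmOrthPoly_two_mul (t : ℕ → R) (x : R) (n : ℕ) :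
    (symmOrthPoly t (2 * n)).eval x =
      ∑ k ∈ range (n + 1), PowerSeries.coeff (n - k) (fracDenom t (2 * n)) * (x ^ 2) ^ k := by
  rw [eval_symmOrthPoly_eq_sum t x (2 * n) n (by omega), ← sum_range_reflect]
  refine sum_congr rfl fun k hk => ?_
  have := mem_range.1 hk
  rw [← pow_mul, show n + 1 - 1 - k = n - k by omega, show 2 * n - 2 * (n - k) = 2 * k by omega]

lemma eval_zero_symmOrthPoly_two_mul (t : ℕ → R) (n : ℕ) :
    (symmOrthPoly t (2 * n)).eval 0 = ∏ i ∈ range n, -t (2 * i) := by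
  induction n with
  | zero => simp [symmOrthPoly]
  | succ n ih =>
    rw [prod_range_succ, ← ih, show 2 * (n + 1) = 2 * n + 2 by ring, symmOrthPoly]
    simp [mul_comm]

/-- Denominators and numerators share a three-term recurrence, hence so does the error; `hh (n + 2)`
shows that the product on the right obeys it too. -/
lemma fracDenom_mul_sub (t : ℕ → R) (h : ℕ → PowerSeries R)
    (hh : ∀ n, h n = 1 + PowerSeries.C (t n) * PowerSeries.X * (h n * h (n + 1))) :
    ∀ n, fracDenom t (n + 1) * h 0 - fracDenom (fun m => t (m + 1)) n =
      PowerSeries.X ^ (n + 1) * (PowerSeries.C (∏ i ∈ range (n + 1), t i) *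
        ∏ i ∈ range (n + 2), h i)
  | 0 => by
    simp only [fracDenom, prod_range_succ, prod_range_zero, one_mul]
    linear_combination hh 0
  | 1 => by
    simp only [fracDenom, prod_range_succ, prod_range_zero, one_mul, map_mul]
    linear_combination hh 0 + PowerSeries.C (t 0) * PowerSeries.X * h 0 * hh 1
  | n + 2 => by
    have h1 := fracDenom_mul_sub t h hh n
    have h2 := fracDenom_mul_sub t h hh (n + 1)
    rw [fracDenom_add_two t (n + 1), fracDenom_add_two (fun m => t (m + 1)) n,
      prod_range_succ _ (n + 2), prod_range_succ _ (n + 1), prod_range_succ _ (n + 3),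
      prod_range_succ _ (n + 2)]
    rw [prod_range_succ _ (n + 1), prod_range_succ _ (n + 2)] at h2
    simp only [map_mul] at h1 h2 ⊢
    linear_combination h2 - PowerSeries.C (t (n + 1)) * PowerSeries.X * h1 +
      PowerSeries.C (t (n + 1)) * PowerSeries.X * PowerSeries.X ^ (n + 1) *
      PowerSeries.C (∏ i ∈ range (n + 1), t i) * (∏ i ∈ range (n + 2), h i) * hh (n + 2)

/-- Reversed coefficients of `D` turn a combination of Hankel columns into a Cauchy product. -/
lemma sum_coeff_sub_mul_coeff (D H : PowerSeries R) (n i : ℕ)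
    (hD : ∀ k, n < k → PowerSeries.coeff k D = 0) :
    ∑ j : Fin (n + 1), PowerSeries.coeff (n - j) D * PowerSeries.coeff (i + j) H =
      PowerSeries.coeff (n + i) (D * H) := by
  rw [Fin.sum_univ_eq_sum_range
      (fun j => PowerSeries.coeff (n - j) D * PowerSeries.coeff (i + j) H) (n + 1),
    PowerSeries.coeff_mul, Nat.sum_antidiagonal_eq_sum_range_succ
      (fun p q => PowerSeries.coeff p D * PowerSeries.coeff q H), ← sum_range_reflect]
  have hsub : range (n + 1) ⊆ range (n + i).succ := range_subset_range.2 (by omega)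
  rw [← sum_subset hsub fun k _ hk => by
    rw [hD k (by simpa using hk), zero_mul]]
  refine sum_congr rfl fun k hk => ?_
  have := mem_range.1 hk
  rw [show n - (n + 1 - 1 - k) = k by omega, show i + (n + 1 - 1 - k) = n + i - k by omega]

lemma sumPoly_coeff (F : PowerSeries R) (m : ℕ) (y : R) :
    sumPoly (fun m => PowerSeries.coeff m F) m y =
      PowerSeries.coeff m (F * PowerSeries.mk fun k => y ^ k) := by
  rw [mul_comm, PowerSeries.coeff_mul, Nat.sum_antidiagonal_eq_sum_range_succ
    (fun p q => PowerSeries.coeff p (PowerSeries.mk fun k => y ^ k) * PowerSeries.coeff q F),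
    sumPoly]
  simp [mul_comm]

lemma sumPoly_succ (a : ℕ → R) (m : ℕ) (y : R) :
    sumPoly a (m + 1) y = a (m + 1) + y * sumPoly a m y := by
  rw [sumPoly, sumPoly, sum_range_succ', mul_sum, add_comm]
  congr 1
  · simp
  · refine sum_congr rfl fun k _ => ?_
    rw [Nat.add_sub_add_right]
    ring

lemma det_eq_mul_det_submatrix_of_sum_eq_zero {n : ℕ} (A : Matrix (Fin (n + 1)) (Fin (n + 1)) R)
    (q : Fin (n + 1) → R) (hq : q (Fin.last n) = 1) (i₀ : Fin (n + 1))
    (h : ∀ i, i ≠ i₀ → ∑ j, q j * A i j = 0) :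
    A.det = (-1) ^ ((i₀ : ℕ) + n) * (∑ j, q j * A i₀ j) *
      (A.submatrix i₀.succAbove Fin.castSucc).det := by
  have h1 := Matrix.det_updateCol_sum A (Fin.last n) q
  rw [hq, one_smul] at h1
  rw [← h1, Matrix.det_succ_column _ (Fin.last n), sum_eq_single i₀]
  · rw [Matrix.submatrix_updateCol_succAbove]
    simp
  · intro i _ hi
    simp [h i hi]
  · simp

/-- The Hankel matrix of the sequence `a 1, a 2, …`. -/
def shiftedHankel (a : ℕ → R) (n : ℕ) : Matrix (Fin n) (Fin n) R :=
  Matrix.of fun i j => a (i + j + 1)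

/-- Subtracting `y` times the preceding row leaves `a(i+j)`, since `r(m+1, y) - y r(m, y) = a(m+1)`.
-/
lemma hankelDet_eq_mul_det_shiftedHankel (a : ℕ → R) (n : ℕ) (y : R) (q : Fin (n + 1) → R)
    (hq : q (Fin.last n) = 1) (h : ∀ i < n, ∑ j, q j * a (i + 1 + j) = 0) :
    hankelDet a n y =
      (-1) ^ n * (∑ j, q j * sumPoly a j y) * (shiftedHankel a n).det := by
  let B : Matrix (Fin (n + 1)) (Fin (n + 1)) R :=
    Matrix.of (Fin.cons (fun j => sumPoly a j y) fun i j => a ((i : ℕ) + 1 + j))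
  have hB : hankelDet a n y = B.det := by
    refine Matrix.det_eq_of_forall_row_eq_smul_add_pred (fun _ => y) (fun j => ?_)
      fun i j => ?_
    · simp [B]
    · simp [B, add_right_comm _ 1, sumPoly_succ]
  rw [hB, det_eq_mul_det_submatrix_of_sum_eq_zero B q hq 0]
  · congr 1
    · simp [B]
    · congr 1
      ext i j
      simp [B, shiftedHankel, add_right_comm]
  · intro i hi
    obtain ⟨i, rfl⟩ := Fin.exists_succ_eq.2 hi
    simpa [B] using h i i.2

section

variable (t : ℕ → R) (h : ℕ → PowerSeries R)
  (hh : ∀ n, h n = 1 + PowerSeries.C (t n) * PowerSeries.X * (h n * h (n + 1)))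

include hh

/-- The error starts in degree `2n+1`. The factor `g` is 1 for orthogonality and the geometric
series in `x²` for the top entry. -/
lemma coeff_fracDenom_mul_of_lt {n k : ℕ} (hk : k < 2 * n + 1) (g : PowerSeries R) :
    PowerSeries.coeff k (fracDenom t (2 * n + 1) * (h 0 * g)) =
      PowerSeries.coeff k (fracDenom (fun m => t (m + 1)) (2 * n) * g) := by
  have h1 := fracDenom_mul_sub t h hh (2 * n)
  rw [← mul_assoc, eq_add_of_sub_eq h1, add_mul, map_add, mul_assoc,
    PowerSeries.coeff_X_pow_mul', if_neg (by omega), zero_add]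

lemma coeff_fracDenom_mul (n : ℕ) :
    PowerSeries.coeff (2 * n + 1) (fracDenom t (2 * n + 1) * h 0) =
      ∏ i ∈ range (2 * n + 1), t i := by
  have h1 := fracDenom_mul_sub t h hh (2 * n)
  have h0 : ∀ n, PowerSeries.constantCoeff (h n) = 1 := fun n => by rw [hh]; simp
  rw [eq_add_of_sub_eq h1, map_add, PowerSeries.coeff_X_pow_mul', if_pos le_rfl,
    coeff_fracDenom_eq_zero _ _ _ (by omega), Nat.sub_self]
  simp [h0, map_prod]

lemma sum_coeff_fracDenom_mul_coeff {n i : ℕ} (hi : i < n) :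
    ∑ j : Fin (n + 1), PowerSeries.coeff (n - j) (fracDenom t (2 * n + 1)) *
      PowerSeries.coeff (i + 1 + j) (h 0) = 0 := by
  rw [sum_coeff_sub_mul_coeff _ _ _ _ fun k hk => coeff_fracDenom_eq_zero _ _ _ (by omega),
    ← mul_one (h 0), coeff_fracDenom_mul_of_lt t h hh (by omega), mul_one,
    coeff_fracDenom_eq_zero _ _ _ (by omega)]

/-- The same column combination leaves only the bottom entry, the leading coefficient of the error.
-/
lemma det_shiftedHankel_succ (n : ℕ) :
    (shiftedHankel (fun m => PowerSeries.coeff m (h 0)) (n + 1)).det =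
      (∏ i ∈ range (2 * n + 1), t i) *
        (shiftedHankel (fun m => PowerSeries.coeff m (h 0)) n).det := by
  rw [det_eq_mul_det_submatrix_of_sum_eq_zero _
    (fun j => PowerSeries.coeff (n - j) (fracDenom t (2 * n + 1)))
    (by simp [coeff_fracDenom_zero, -PowerSeries.coeff_zero_eq_constantCoeff]) (Fin.last n)]
  · congr 1
    · simp only [shiftedHankel, Matrix.of_apply, Fin.val_last, add_right_comm _ _ 1]
      rw [sum_coeff_sub_mul_coeff _ _ _ _ fun k hk => coeff_fracDenom_eq_zero _ _ _ (by omega),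
        show n + (n + 1) = 2 * n + 1 by ring, coeff_fracDenom_mul t h hh, Even.neg_one_pow ⟨n, rfl⟩,
        one_mul]
    · congr 1
      ext i j
      simp [shiftedHankel]
  · intro i hi
    simp only [shiftedHankel, Matrix.of_apply, add_right_comm _ _ 1]
    exact sum_coeff_fracDenom_mul_coeff t h hh (Fin.val_lt_last hi)

/-- The Hankel determinants of the polynomials `r(n, x ^ 2)` of a Stieltjes continued fraction are
multiples of the orthogonal polynomials of the shifted fraction. -/
lemma hankelDet_sq_eq (n : ℕ) (x : R) :
    hankelDet (fun m => PowerSeries.coeff m (h 0)) n (x ^ 2) =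
      (-1) ^ n * (symmOrthPoly (fun m => t (m + 1)) (2 * n)).eval x *
        (shiftedHankel (fun m => PowerSeries.coeff m (h 0)) n).det := by
  rw [hankelDet_eq_mul_det_shiftedHankel _ n (x ^ 2)
    (fun j => PowerSeries.coeff (n - j) (fracDenom t (2 * n + 1)))
    (by simp [coeff_fracDenom_zero, -PowerSeries.coeff_zero_eq_constantCoeff])
    fun i hi => sum_coeff_fracDenom_mul_coeff t h hh hi]
  congr 2
  have key := sum_coeff_sub_mul_coeff (fracDenom t (2 * n + 1))
    (h 0 * PowerSeries.mk fun k => (x ^ 2) ^ k) n 0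
    fun k hk => coeff_fracDenom_eq_zero _ _ _ (by omega)
  simp only [zero_add, ← sumPoly_coeff, add_zero] at key
  rw [key, coeff_fracDenom_mul_of_lt t h hh (by omega), ← sumPoly_coeff,
    eval_symmOrthPoly_two_mul, sumPoly]

end

end ContinuedFraction

/-! ### Nonvanishing and the quotient of determinants -/

section Field

variable {K : Type*} [Field K] (t : ℕ → K) (h : ℕ → PowerSeries K)
  (hh : ∀ n, h n = 1 + PowerSeries.C (t n) * PowerSeries.X * (h n * h (n + 1)))
  (ht : ∀ n, t n ≠ 0)

include hh ht

lemma det_shiftedHankel_ne_zero (n : ℕ) :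
    (shiftedHankel (fun m => PowerSeries.coeff m (h 0)) n).det ≠ 0 := by
  induction n with
  | zero => simp
  | succ n ih =>
    rw [det_shiftedHankel_succ t h hh]
    exact mul_ne_zero (prod_ne_zero_iff.2 fun i _ => ht i) ih

lemma hankelDet_zero_ne_zero (n : ℕ) :
    hankelDet (fun m => PowerSeries.coeff m (h 0)) n 0 ≠ 0 := by
  have := hankelDet_sq_eq t h hh n 0
  rw [zero_pow two_ne_zero, eval_zero_symmOrthPoly_two_mul] at this
  rw [this]
  exact mul_ne_zero (mul_ne_zero (pow_ne_zero _ (neg_ne_zero.2 one_ne_zero))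
    (prod_ne_zero_iff.2 fun i _ => neg_ne_zero.2 (ht _))) (det_shiftedHankel_ne_zero t h hh ht n)

lemma hankelDet_sq_div_hankelDet_zero (n : ℕ) (x : K) :
    hankelDet (fun m => PowerSeries.coeff m (h 0)) n (x ^ 2) /
        hankelDet (fun m => PowerSeries.coeff m (h 0)) n 0 =
      (symmOrthPoly (fun m => t (m + 1)) (2 * n)).eval x / ∏ i ∈ range n, -t (2 * i + 1) := by
  have h0 := hankelDet_sq_eq t h hh n 0
  rw [zero_pow two_ne_zero, eval_zero_symmOrthPoly_two_mul] at h0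
  rw [hankelDet_sq_eq t h hh n x, h0, mul_div_mul_right _ _ (det_shiftedHankel_ne_zero t h hh ht n),
    mul_div_mul_left _ _ (pow_ne_zero _ (neg_ne_zero.2 one_ne_zero))]

end Field

/-! ### Binomial sums and the recurrence of the even-indexed polynomials -/

section Binomial

variable {R : Type*} [CommRing R]

/-- The convolution of the columns `k` of Pascal's triangle and of `binom (k + j - 1) j * b ^ j`. -/
def chooseConv (b : R) (n k : ℕ) : R :=
  ∑ j ∈ range (n + 1), ((n - j).choose k : R) * ((k + j - 1).choose j : R) * b ^ j

lemma chooseConv_eq_zero (b : R) {n k : ℕ} (h : n < k) : chooseConv b n k = 0 :=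
  sum_eq_zero fun j _ => by rw [Nat.choose_eq_zero_of_lt (by omega)]; simp

/-- Truncated subtraction realises the convention `binom(-1, 0) = 1`; the terms with `j > 0` vanish.
-/
lemma chooseConv_zero_right (b : R) (n : ℕ) : chooseConv b n 0 = 1 := by
  rw [chooseConv, sum_range_succ']
  simp

lemma chooseConv_eq_sum_range_sub (b : R) {n k : ℕ} (hk : k ≤ n) :
    chooseConv b n k = ∑ j ∈ range (n - k + 1),
      ((n - j).choose k : R) * ((k + j - 1).choose j : R) * b ^ j := by
  refine (sum_subset (range_subset_range.2 (by omega)) fun j hj hj' => ?_).symm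
  rw [mem_range] at hj hj'
  rw [Nat.choose_eq_zero_of_lt (by omega)]
  simp

lemma one_sub_X_mul_mk_choose (k : ℕ) :
    (1 - PowerSeries.X) * PowerSeries.mk (fun m => (m.choose (k + 1) : R)) =
      PowerSeries.X * PowerSeries.mk fun m => (m.choose k : R) := by
  ext n
  rw [sub_mul, one_mul, map_sub]
  cases n with
  | zero => simp
  | succ n =>
    simp [PowerSeries.coeff_succ_X_mul, Nat.choose_succ_succ]

lemma one_sub_mul_mk_choose_mul_pow (b : R) (k : ℕ) :
    (1 - PowerSeries.C b * PowerSeries.X) *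
        PowerSeries.mk (fun j => ((k + 1 + j - 1).choose j : R) * b ^ j) =
      PowerSeries.mk fun j => ((k + j - 1).choose j : R) * b ^ j := by
  ext n
  rw [sub_mul, one_mul, map_sub, mul_assoc, PowerSeries.coeff_C_mul]
  cases n with
  | zero => simp
  | succ n =>
    rw [PowerSeries.coeff_succ_X_mul, PowerSeries.coeff_mk, PowerSeries.coeff_mk,
      PowerSeries.coeff_mk, show k + 1 + (n + 1) - 1 = k + n + 1 by omega,
      show k + (n + 1) - 1 = k + n by omega, show k + 1 + n - 1 = k + n by omega,
      Nat.choose_succ_succ]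
    push_cast
    ring

lemma mk_chooseConv (b : R) (k : ℕ) :
    PowerSeries.mk (fun n => chooseConv b n k) =
      PowerSeries.mk (fun j => ((k + j - 1).choose j : R) * b ^ j) *
        PowerSeries.mk fun m => (m.choose k : R) := by
  ext n
  rw [PowerSeries.coeff_mul, Nat.sum_antidiagonal_eq_sum_range_succ (fun p q =>
    PowerSeries.coeff p (PowerSeries.mk fun j => ((k + j - 1).choose j : R) * b ^ j) *
      PowerSeries.coeff q (PowerSeries.mk fun m => (m.choose k : R))), PowerSeries.coeff_mk,
    chooseConv]
  refine sum_congr rfl fun j _ => ?_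
  rw [PowerSeries.coeff_mk, PowerSeries.coeff_mk]
  ring

/-- Passing from column `k` to `k + 1` multiplies the generating function by `X / ((1 - X)(1 -
bX))`. -/
lemma chooseConv_add_two (b : R) (n k : ℕ) :
    chooseConv b (n + 2) (k + 1) =
      (1 + b) * chooseConv b (n + 1) (k + 1) - b * chooseConv b n (k + 1) +
        chooseConv b (n + 1) k := by
  have key : PowerSeries.mk (fun n => chooseConv b n (k + 1)) -
      PowerSeries.C (1 + b) * (PowerSeries.X * PowerSeries.mk fun n => chooseConv b n (k + 1)) +
      PowerSeries.C b * (PowerSeries.X * (PowerSeries.X *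
        PowerSeries.mk fun n => chooseConv b n (k + 1))) =
      PowerSeries.X * PowerSeries.mk fun n => chooseConv b n k := by
    rw [mk_chooseConv, mk_chooseConv, ← one_sub_mul_mk_choose_mul_pow b k, map_add, map_one]
    linear_combination (1 - PowerSeries.C b * PowerSeries.X) *
      PowerSeries.mk (fun j => ((k + 1 + j - 1).choose j : R) * b ^ j) *
      one_sub_X_mul_mk_choose (R := R) k
  have := congrArg (PowerSeries.coeff (n + 2)) key
  simp only [LinearMap.map_add, LinearMap.map_sub, PowerSeries.coeff_C_mul,
    PowerSeries.coeff_succ_X_mul,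
    PowerSeries.coeff_mk] at this
  linear_combination this

lemma sum_pow_mul_chooseConv_of_le (b z : R) {n N : ℕ} (h : n ≤ N) :
    ∑ k ∈ range (N + 1), z ^ k * chooseConv b n k =
      ∑ k ∈ range (n + 1), z ^ k * chooseConv b n k :=
  (sum_subset (range_subset_range.2 (by omega)) fun k _ hk => by
    rw [chooseConv_eq_zero b (by simpa using hk), mul_zero]).symm

lemma sum_pow_mul_chooseConv_add_two (b z : R) (n : ℕ) :
    ∑ k ∈ range (n + 3), z ^ k * chooseConv b (n + 2) k =
      (1 + b + z) * ∑ k ∈ range (n + 2), z ^ k * chooseConv b (n + 1) k -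
        b * ∑ k ∈ range (n + 1), z ^ k * chooseConv b n k := by
  have h0 := sum_pow_mul_chooseConv_of_le b z (show n ≤ n + 2 by omega)
  have h1 := sum_pow_mul_chooseConv_of_le b z (show n + 1 ≤ n + 2 by omega)
  rw [sum_range_succ', chooseConv_zero_right] at h0 h1 ⊢
  have key : ∑ k ∈ range (n + 2), z ^ (k + 1) * chooseConv b (n + 2) (k + 1) =
      (1 + b) * ∑ k ∈ range (n + 2), z ^ (k + 1) * chooseConv b (n + 1) (k + 1) -
      b * ∑ k ∈ range (n + 2), z ^ (k + 1) * chooseConv b n (k + 1) +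
      z * ∑ k ∈ range (n + 2), z ^ k * chooseConv b (n + 1) k := by
    rw [mul_sum, mul_sum, mul_sum, ← sum_sub_distrib, ← sum_add_distrib]
    refine sum_congr rfl fun k _ => ?_
    rw [chooseConv_add_two]
    ring
  linear_combination key + (1 + b) * h1 - b * h0

/-- The recurrence of `∑ k, z ^ k * chooseConv b n k` determines it. -/
lemma eq_sum_pow_mul_chooseConv (b z : R) (y : ℕ → R) (h0 : y 0 = 1) (h1 : y 1 = 1 + z)
    (h2 : ∀ n, y (n + 2) = (1 + b + z) * y (n + 1) - b * y n) :
    ∀ n, y n = ∑ k ∈ range (n + 1), z ^ k * chooseConv b n k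
  | 0 => by simp [h0, chooseConv_zero_right]
  | 1 => by
    simp [h1, chooseConv, sum_range_succ]
  | n + 2 => by
    rw [h2, eq_sum_pow_mul_chooseConv b z y h0 h1 h2 (n + 1),
      eq_sum_pow_mul_chooseConv b z y h0 h1 h2 n, sum_pow_mul_chooseConv_add_two]

/-- The odd-indexed polynomials are eliminated through `x p_{2n+1} = p_{2n+2} + t_{2n} p_{2n}`. -/
lemma eval_symmOrthPoly_two_mul_add_two (t : ℕ → R) (x : R) (n : ℕ) :
    (symmOrthPoly t (2 * (n + 2))).eval x =
      (x ^ 2 - t (2 * n + 1) - t (2 * n + 2)) * (symmOrthPoly t (2 * (n + 1))).eval x -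
        t (2 * n) * t (2 * n + 1) * (symmOrthPoly t (2 * n)).eval x := by
  rw [show 2 * (n + 2) = 2 * n + 2 + 2 by ring, show 2 * (n + 1) = 2 * n + 2 by ring,
    symmOrthPoly, symmOrthPoly, symmOrthPoly]
  simp only [eval_sub, eval_mul, eval_X, eval_C]
  ring

lemma oneTwo_two_mul (m : ℕ) : oneTwo R (2 * m) = 1 := by simp [oneTwo]

lemma oneTwo_two_mul_add_one (m : ℕ) : oneTwo R (2 * m + 1) = 2 := by simp [oneTwo]

lemma oneTwo_add_two (m : ℕ) : oneTwo R (m + 2) = oneTwo R m := by simp [oneTwo, Nat.even_add]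

lemma neg_one_pow_mul_eval_symmOrthPoly_oneTwo (n : ℕ) (x : R) :
    (-1) ^ n * (symmOrthPoly (oneTwo R) (2 * n)).eval x =
      ∑ k ∈ range (n + 1), (-x ^ 2) ^ k * chooseConv 2 n k := by
  refine eq_sum_pow_mul_chooseConv 2 (-x ^ 2)
    (fun n => (-1) ^ n * (symmOrthPoly (oneTwo R) (2 * n)).eval x) ?_ ?_ (fun n => ?_) n
  · simp [symmOrthPoly]
  · simp [symmOrthPoly, oneTwo]
    ring
  · simp only [eval_symmOrthPoly_two_mul_add_two, oneTwo_add_two, oneTwo_two_mul,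
      oneTwo_two_mul_add_one]
    ring

end Binomial

/-! ### Schröder series as tails of a periodic continued fraction -/

section Schroder

variable {K : Type*} [Field K]

lemma neg_one_pow_div_mul_eval_symmOrthPoly_twoOne [CharZero K] (n : ℕ) (x : K) :
    (-1) ^ n / 2 ^ n * (symmOrthPoly (fun m => oneTwo K (m + 1)) (2 * n)).eval x =
      ∑ k ∈ range (n + 1), (-(x ^ 2 / 2)) ^ k * chooseConv (1 / 2) n k := by
  refine eq_sum_pow_mul_chooseConv (1 / 2) (-(x ^ 2 / 2)) (fun n => (-1) ^ n / 2 ^ n *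
    (symmOrthPoly (fun m => oneTwo K (m + 1)) (2 * n)).eval x) ?_ ?_ (fun n => ?_) n
  · simp [symmOrthPoly]
  · simp [symmOrthPoly, oneTwo]
    ring
  · simp only [eval_symmOrthPoly_two_mul_add_two, add_assoc, Nat.reduceAdd]
    simp only [oneTwo_add_two, oneTwo_two_mul, oneTwo_two_mul_add_one]
    rw [pow_add, pow_add, pow_add, pow_add]
    field_simp
    ring

/-- The generating function of the large Schröder numbers. -/
def largeSeries (K : Type*) [Field K] : PowerSeries K :=
  PowerSeries.mk fun m => (Nat.largeSchroder m : K)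

/-- The generating function of the little Schröder numbers. -/
def littleSeries (K : Type*) [Field K] : PowerSeries K :=
  PowerSeries.mk fun m => (littleSchroder m : K)

lemma largeSeries_eq : largeSeries K = 1 + PowerSeries.X * largeSeries K +
    PowerSeries.X * largeSeries K ^ 2 := by
  have h : largeSeries K = PowerSeries.map (Nat.castRingHom K) PowerSeries.largeSchroderSeries := by
    ext n
    simp [largeSeries]
  have h' := congrArg (PowerSeries.map (Nat.castRingHom K))
    PowerSeries.largeSchroderSeries_eq_one_add_X_mul_largeSchroderSeries_add_X_mul_largeSchroderSeries_sq
  simpa only [map_add, map_mul, map_pow, map_one, PowerSeries.map_X, ← h] using h'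

lemma two_mul_littleSeries : 2 * littleSeries K = 1 + largeSeries K := by
  ext n
  rw [← map_ofNat (PowerSeries.C (R := K)) 2, PowerSeries.coeff_C_mul, map_add,
    PowerSeries.coeff_one, littleSeries, largeSeries, PowerSeries.coeff_mk, PowerSeries.coeff_mk,
    littleSchroder]
  -- The doubling identity needs `n ≠ 0`; the summand 1 corrects the constant term.
  rcases eq_or_ne n 0 with rfl | hn
  · norm_num
  · rw [if_neg hn, zero_add, ← Nat.two_mul_smallSchroder_succ hn]
    push_cast
    rfl

/-- Substituting `2S = 1 + L` gives `2(1 + XSL) = 1 + (1 + XL + XL²) = 1 + L = 2S`; then halve. -/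
lemma littleSeries_eq [CharZero K] : littleSeries K =
    1 + PowerSeries.X * (littleSeries K * largeSeries K) := by
  have h2 : (PowerSeries.C (2 : K)⁻¹) * 2 = 1 := by
    rw [← map_ofNat (PowerSeries.C (R := K)) 2, ← map_mul]
    simp
  linear_combination (PowerSeries.C (2 : K)⁻¹) * (largeSeries_eq (K := K)) +
    (PowerSeries.C (2 : K)⁻¹) * (1 - PowerSeries.X * largeSeries K) *
      (two_mul_littleSeries (K := K)) -
    (littleSeries K - 1 - PowerSeries.X * (littleSeries K * largeSeries K)) * h2

lemma largeSeries_eq_one_add_littleSeries : largeSeries K =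
    1 + PowerSeries.C 2 * PowerSeries.X * (largeSeries K * littleSeries K) := by
  rw [map_ofNat]
  linear_combination largeSeries_eq (K := K) -
    PowerSeries.X * largeSeries K * two_mul_littleSeries (K := K)

/-- The tails of the continued fraction of the little Schröder numbers. -/
def schroderTail (K : Type*) [Field K] (n : ℕ) : PowerSeries K :=
  if Even n then littleSeries K else largeSeries K

lemma schroderTail_eq [CharZero K] (n : ℕ) : schroderTail K n = 1 + PowerSeries.C (oneTwo K n) *
    PowerSeries.X * (schroderTail K n * schroderTail K (n + 1)) := by
  by_cases hn : Even n
  · simpa [schroderTail, oneTwo, hn, Nat.even_add_one] using littleSeries_eq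
  · simpa [schroderTail, oneTwo, hn, Nat.even_add_one] using
      largeSeries_eq_one_add_littleSeries

lemma oneTwo_ne_zero [CharZero K] (n : ℕ) : oneTwo K n ≠ 0 := by
  rw [oneTwo]
  split_ifs <;> simp

end Schroder

theorem corollary6 {K : Type*} [Field K] [CharZero K] (n : ℕ) (x : K) :
    (hankelDet (fun m => (littleSchroder m : K)) n 0 ≠ 0 ∧
      hankelDet (fun m => (littleSchroder m : K)) n (x ^ 2) /
          hankelDet (fun m => (littleSchroder m : K)) n 0
        = (-1) ^ n / 2 ^ n * (symmOrthPoly (fun m => oneTwo K (m + 1)) (2 * n)).eval x ∧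
      (-1) ^ n / 2 ^ n * (symmOrthPoly (fun m => oneTwo K (m + 1)) (2 * n)).eval x
        = ∑ k ∈ range (n + 1), (-1) ^ k * x ^ (2 * k) *
            ∑ j ∈ range (n - k + 1), ((n - j).choose k : K) * ((k + j - 1).choose j : K) *
              (2 : K) ^ (-(k : ℤ) - (j : ℤ))) ∧
    (hankelDet (fun m => (Nat.largeSchroder m : K)) n 0 ≠ 0 ∧
      hankelDet (fun m => (Nat.largeSchroder m : K)) n (x ^ 2) /
          hankelDet (fun m => (Nat.largeSchroder m : K)) n 0
        = (-1) ^ n * (symmOrthPoly (oneTwo K) (2 * n)).eval x ∧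
      (-1) ^ n * (symmOrthPoly (oneTwo K) (2 * n)).eval x
        = ∑ k ∈ range (n + 1), (-1) ^ k * x ^ (2 * k) *
            ∑ j ∈ range (n - k + 1), ((n - j).choose k : K) * ((k + j - 1).choose j : K) *
              (2 : K) ^ j) := by
  have hlittle : (fun m => (littleSchroder m : K)) =
      fun m => PowerSeries.coeff m (schroderTail K 0) := by
    funext m
    simp [schroderTail, littleSeries]
  -- The large numbers start one tail later, so the shift in `hankelDet_sq_eq` returns 1, 2, 1, 2,
  -- ….
  have hlarge : (fun m => (Nat.largeSchroder m : K)) =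
      fun m => PowerSeries.coeff m (schroderTail K (0 + 1)) := by
    funext m
    simp [schroderTail, largeSeries]
  have hsq : ((-1 : K) ^ n)⁻¹ = (-1) ^ n := by rw [← inv_pow, inv_neg_one]
  refine ⟨⟨?_, ?_, ?_⟩, ?_, ?_, ?_⟩
  · rw [hlittle]
    exact hankelDet_zero_ne_zero (oneTwo K) (schroderTail K) schroderTail_eq oneTwo_ne_zero n
  · rw [hlittle, hankelDet_sq_div_hankelDet_zero (oneTwo K) (schroderTail K) schroderTail_eq
      oneTwo_ne_zero n x]
    simp only [oneTwo_two_mul_add_one, prod_const, card_range]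
    rw [neg_pow, div_eq_inv_mul, mul_inv, hsq, div_eq_mul_inv]
  · rw [neg_one_pow_div_mul_eval_symmOrthPoly_twoOne]
    refine sum_congr rfl fun k hk => ?_
    rw [chooseConv_eq_sum_range_sub _ (Nat.lt_succ_iff.1 (mem_range.1 hk)), mul_sum, mul_sum]
    refine sum_congr rfl fun j _ => ?_
    rw [sub_eq_add_neg, zpow_add₀ two_ne_zero, zpow_neg, zpow_neg, zpow_natCast, zpow_natCast,
      neg_pow, div_pow, one_div, inv_pow, pow_mul]
    ring
  · rw [hlarge]
    exact hankelDet_zero_ne_zero (fun m => oneTwo K (m + 1)) (fun m => schroderTail K (m + 1))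
      (fun m => schroderTail_eq (m + 1)) (fun m => oneTwo_ne_zero (m + 1)) n
  · rw [hlarge, hankelDet_sq_div_hankelDet_zero (fun m => oneTwo K (m + 1))
      (fun m => schroderTail K (m + 1)) (fun m => schroderTail_eq (m + 1))
      (fun m => oneTwo_ne_zero (m + 1)) n x]
    simp only [add_assoc, Nat.reduceAdd]
    simp only [oneTwo_add_two, oneTwo_two_mul, prod_const, card_range]
    rw [div_eq_inv_mul, hsq]
  · rw [neg_one_pow_mul_eval_symmOrthPoly_oneTwo]
    refine sum_congr rfl fun k hk => ?_
    rw [chooseConv_eq_sum_range_sub _ (Nat.lt_succ_iff.1 (mem_range.1 hk)), neg_pow, pow_mul]
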